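/- Let $m\in\mathbb N$ and, for every $k\ge 0$, let $P_{ij}(k)\ge 0$ ($i,j\in[m]=\{1,\dots,m\}$, $i\ne j$) be numbers with $P_{ij}(k)=P_{ji}(k)$ and $\sum_{i<j}P_{ij}(k)=1$. Let $\{W(k)\}_{k\ge0}$ be an independent sequence of random $m\times m$ real matrices (the extended gossip algorithm on a time-varying network) such that, for every $k\ge0$ and every pair $\{i,j\}\subseteq[m]$ with $i\neq j$, $$W(k)=I-\tfrac12(e_i-e_j)(e_i-e_j)^T\quad\text{with probability }P_{ij}(k),$$ i.e. at each time a pair $\{i,j\}$ of agents is chosen with probability $P_{ij}(k)$, independently over time, and both agents replace their values by the average of the two. For $S\subseteq[m]$ put $P_S(k)=\sum_{i\in S,\,j\in[m]\setminus S}P_{ij}(k)$. If $$\sum_{k=0}^\infty P_S(k)=\infty\qquad\text{for every } S \text{ with } \emptyset\ne S\subsetneq[m],$$ then consensus holds almost surely: with probability one, for every initial state $x(0)\in\mathbb R^m$ the sequence defined by $x(k+1)=W(k)x(k)$, $k\ge0$, satisfies $\lim_{k\to\infty}\|x(k)-c\,e\|=0$ for some scalar $c=c(x(0))$ (depending on the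 realization), where $\|\cdot\|$ is the Euclidean norm and $e$ is the all-ones vector. -/

import Mathlib

open MeasureTheory ProbabilityTheory Filter Topology
open scoped Matrix

/-- The product sigma-algebra of the entries, which is the Borel sigma-algebra. -/
instance gossipMatrixMeasurableSpace {m : ℕ} : MeasurableSpace (Matrix (Fin m) (Fin m) ℝ) :=
  inferInstanceAs (MeasurableSpace (Fin m → Fin m → ℝ))

/-- The matrix `I - (1/2) (e_i - e_j) (e_i - e_j)ᵀ`: agents `i` and `j` replace their values by
the average of the two, all other agents keep theirs. -/
noncomputable def gossipMatrix {m : ℕ} (i j : Fin m) : Matrix (Fin m) (Fin m) ℝ :=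
  1 - (1 / 2 : ℝ) • Matrix.vecMulVec
    (Pi.single i (1 : ℝ) - Pi.single j (1 : ℝ)) (Pi.single i (1 : ℝ) - Pi.single j (1 : ℝ))

/-- `P k i j` is the probability that the pair `{i, j}` (with `i ≠ j`) is chosen at time `k`:
nonnegative, symmetric, and of total mass one over the unordered pairs. -/
structure IsPairProbability {m : ℕ} (P : ℕ → Fin m → Fin m → ℝ) : Prop where
  nonneg : ∀ k i j, i ≠ j → 0 ≤ P k i j
  symm : ∀ k i j, P k i j = P k j i
  sum_eq_one : ∀ k, ∑ i, ∑ j with i < j, P k i j = 1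

/-- The extended gossip algorithm with pair probabilities `P`: an independent chain of random
matrices such that `W k` is the gossip matrix of `{i, j}` with probability `P k i j`. Distinct
pairs have distinct gossip matrices, so this determines the law of the chain. -/
structure IsExtendedGossip {m : ℕ} {Ω : Type*} [MeasurableSpace Ω] (μ : Measure Ω)
    (P : ℕ → Fin m → Fin m → ℝ) (W : ℕ → Ω → Matrix (Fin m) (Fin m) ℝ) : Prop where
  measurable : ∀ k, Measurable (W k)
  indep : iIndepFun W μ
  prob_eq : ∀ k i j, i ≠ j → μ.real {ω | W k ω = gossipMatrix i j} = P k i j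

/-- The probability that the pair chosen joins `S` to its complement. -/
def cutProbability {m : ℕ} (p : Fin m → Fin m → ℝ) (S : Finset (Fin m)) : ℝ :=
  ∑ i ∈ S, ∑ j ∈ Sᶜ, p i j

/-- The system `z (k + 1) = G k * z k` reaches a consensus: every trajectory (for every initial
state `z 0`) converges in the Euclidean norm to a multiple of the all-ones vector. -/
def ReachesConsensus {m : ℕ} (G : ℕ → Matrix (Fin m) (Fin m) ℝ) : Prop :=
  ∀ z : ℕ → Fin m → ℝ, (∀ k, z (k + 1) = G k *ᵥ z k) →
    ∃ c : ℝ, Tendsto (fun k => ‖WithLp.toLp 2 (fun i => z k i - c)‖) atTop (𝓝 0)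

/-! By the second Borel–Cantelli lemma, almost surely each of the finitely many cuts is crossed
infinitely often; the rest is deterministic, so one null set serves all initial states. Averaging a
pair lowers the sum of squares by half its squared difference, so the differences of the chosen
pairs tend to zero. If at a late time the values on `S` lay at least `η` below those off `S`, a pair
crossing the cut would differ by at least `η`, so none is chosen, the gap persists, and the cut is
never crossed again: a contradiction. Without gaps of size `η` the spread is at most `m * η`, and
since the mean is conserved, all values tend to it. -/

/-! ### Algebra of a single gossip step. -/

/-- A gossip step moves the values of the pair along `e_i - e_j`. -/
theorem gossipMatrix_mulVec_apply {m : ℕ} (i j : Fin m) (z : Fin m → ℝ) (k : Fin m) :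
    (gossipMatrix i j *ᵥ z) k = z k - (z i - z j) / 2 *
      ((Pi.single i (1 : ℝ) : Fin m → ℝ) k - (Pi.single j (1 : ℝ) : Fin m → ℝ) k) := by
  simp only [gossipMatrix, Matrix.sub_mulVec, Matrix.one_mulVec, Matrix.smul_mulVec,
    Matrix.vecMulVec_mulVec, sub_dotProduct, single_dotProduct, Pi.sub_apply, Pi.smul_apply,
    smul_eq_mul, one_mul, MulOpposite.smul_eq_mul_unop, MulOpposite.unop_op]
  ring

theorem gossipMatrix_mulVec_left {m : ℕ} {i j : Fin m} (hij : i ≠ j) (z : Fin m → ℝ) :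
    (gossipMatrix i j *ᵥ z) i = (z i + z j) / 2 := by
  rw [gossipMatrix_mulVec_apply]
  simp [hij]
  ring

theorem gossipMatrix_mulVec_right {m : ℕ} {i j : Fin m} (hij : i ≠ j) (z : Fin m → ℝ) :
    (gossipMatrix i j *ᵥ z) j = (z i + z j) / 2 := by
  rw [gossipMatrix_mulVec_apply]
  simp [hij.symm]
  ring

theorem gossipMatrix_mulVec_of_ne {m : ℕ} {i j k : Fin m} (hi : k ≠ i) (hj : k ≠ j)
    (z : Fin m → ℝ) : (gossipMatrix i j *ᵥ z) k = z k := by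
  rw [gossipMatrix_mulVec_apply]
  simp [hi, hj]

theorem sum_gossipMatrix_mulVec {m : ℕ} (i j : Fin m) (z : Fin m → ℝ) :
    ∑ k, (gossipMatrix i j *ᵥ z) k = ∑ k, z k := by
  simp [gossipMatrix_mulVec_apply, Finset.sum_sub_distrib, ← Finset.mul_sum]

/-- A gossip step lowers the sum of squares by half the squared difference of the pair. -/
theorem sum_sq_gossipMatrix_mulVec {m : ℕ} {i j : Fin m} (hij : i ≠ j) (z : Fin m → ℝ) :
    ∑ k, (gossipMatrix i j *ᵥ z) k ^ 2 = ∑ k, z k ^ 2 - (z i - z j) ^ 2 / 2 := by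
  have h : ∀ k, (gossipMatrix i j *ᵥ z) k ^ 2 = z k ^ 2
      - (if k = i then (z i ^ 2 - ((z i + z j) / 2) ^ 2) else 0)
      - (if k = j then (z j ^ 2 - ((z i + z j) / 2) ^ 2) else 0) := by
    intro k
    rcases eq_or_ne k i with rfl | hi
    · rw [gossipMatrix_mulVec_left hij]
      simp [hij]
    · rcases eq_or_ne k j with rfl | hj
      · rw [gossipMatrix_mulVec_right hij]
        simp [hi]
      · rw [gossipMatrix_mulVec_of_ne hi hj]
        simp [hi, hj]
  simp only [h, Finset.sum_sub_distrib, Finset.sum_ite_eq', Finset.mem_univ, if_true]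
  ring

/-- The gossip matrix determines its pair. -/
theorem eq_or_eq_of_gossipMatrix_eq {m : ℕ} {i j a b : Fin m} (hij : i ≠ j)
    (h : gossipMatrix i j = gossipMatrix a b) : (i = a ∧ j = b) ∨ (i = b ∧ j = a) := by
  -- The off-diagonal entry at `(i, j)` is `1 / 2` on the left, and nonzero on the right only if
  -- `{a, b} = {i, j}`.
  have h1 := congrFun (congrFun h i) j
  by_contra hc
  simp only [gossipMatrix, Matrix.sub_apply, Matrix.smul_apply, Matrix.vecMulVec_apply,
    Pi.sub_apply, Pi.single_apply, smul_eq_mul, Matrix.one_apply, hij, hij.symm, if_true,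
    if_false] at h1
  by_cases h2 : i = a <;> by_cases h3 : i = b <;> by_cases h4 : j = a <;> by_cases h5 : j = b <;>
    simp [h2, h3, h4, h5] at h1 hc <;> grind

/-! ### Deterministic convergence. -/

/-- A gap across a set survives a gossip step of a pair that does not cross the gap. -/
theorem gap_gossipMatrix_mulVec {m : ℕ} {S : Finset (Fin m)} {η : ℝ} {z : Fin m → ℝ}
    (hgap : ∀ i ∈ S, ∀ j ∉ S, z i + η ≤ z j) {a b : Fin m} (hab : a ≠ b)
    (hclose : |z a - z b| < η) :
    ∀ i ∈ S, ∀ j ∉ S, (gossipMatrix a b *ᵥ z) i + η ≤ (gossipMatrix a b *ᵥ z) j := by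
  have hside : a ∈ S ↔ b ∈ S := by
    rw [abs_lt] at hclose
    constructor
    · intro ha
      by_contra hb
      linarith [hgap a ha b hb]
    · intro hb
      by_contra ha
      linarith [hgap b hb a ha]
  have hval : ∀ k, (gossipMatrix a b *ᵥ z) k = z k ∨
      ((k = a ∨ k = b) ∧ (gossipMatrix a b *ᵥ z) k = (z a + z b) / 2) := by
    intro k
    rcases eq_or_ne k a with rfl | ha
    · exact Or.inr ⟨Or.inl rfl, gossipMatrix_mulVec_left hab z⟩
    · rcases eq_or_ne k b with rfl | hb
      · exact Or.inr ⟨Or.inr rfl, gossipMatrix_mulVec_right hab z⟩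
      · exact Or.inl (gossipMatrix_mulVec_of_ne ha hb z)
  intro i hi j hj
  rcases hval i with h1 | ⟨h1, h1'⟩
  · rcases hval j with h2 | ⟨h2, h2'⟩
    · rw [h1, h2]
      exact hgap i hi j hj
    · have hb : b ∉ S := by rcases h2 with rfl | rfl <;> tauto
      rw [h1, h2']
      linarith [hgap i hi a (mt hside.1 hb), hgap i hi b hb]
  · have hb : b ∈ S := by rcases h1 with rfl | rfl <;> tauto
    rcases hval j with h2 | ⟨h2, h2'⟩
    · rw [h1', h2]
      linarith [hgap a (hside.2 hb) j hj, hgap b hb j hj]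
    · rcases h2 with rfl | rfl <;> tauto

/-- Finitely many values without a gap of size `η` have spread at most `m * η`. -/
theorem abs_sub_le_of_forall_not_gap {m : ℕ} {η : ℝ} {z : Fin m → ℝ} (hη : 0 < η)
    (h : ∀ S : Finset (Fin m), S.Nonempty → S ≠ Finset.univ → ∃ i ∈ S, ∃ j ∉ S, z j < z i + η)
    (a b : Fin m) : |z a - z b| ≤ m * η := by
  have : Nonempty (Fin m) := ⟨a⟩
  obtain ⟨i₀, hi₀⟩ := Finite.exists_min z
  -- `S 0` is empty and `S 1` contains the minimizer. Afterwards the absence of a gap adds an agent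
  -- at each step until all are included, so `m` steps suffice.
  let S : ℕ → Finset (Fin m) := fun t => Finset.univ.filter fun i => z i < z i₀ + t * η
  have hmono : ∀ t, S t ⊆ S (t + 1) := by
    intro t i
    simp only [S, Finset.mem_filter, Finset.mem_univ, true_and]
    push_cast
    intro hi
    linarith
  have hcard : ∀ t, t ≤ (S t).card ∨ S t = Finset.univ := by
    intro t
    induction t with
    | zero => exact Or.inl (Nat.zero_le _)
    | succ t ih =>
      by_cases hu : S t = Finset.univ
      · exact Or.inr (Finset.univ_subset_iff.1 (hu ▸ hmono t))
      · left
        suffices hlt : (S t).card < (S (t + 1)).card by have := ih.resolve_right hu; omega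
        refine Finset.card_lt_card ((Finset.ssubset_iff_of_subset (hmono t)).2 ?_)
        rcases (S t).eq_empty_or_nonempty with he | hne
        · refine ⟨i₀, ?_, by simp [he]⟩
          simp only [S, Finset.mem_filter, Finset.mem_univ, true_and]
          push_cast
          nlinarith [mul_nonneg (Nat.cast_nonneg (α := ℝ) t) hη.le]
        · obtain ⟨i, hi, j, hj, hij⟩ := h _ hne hu
          refine ⟨j, ?_, hj⟩
          simp only [S, Finset.mem_filter, Finset.mem_univ, true_and] at hi ⊢
          push_cast
          linarith
  have huniv : S m = Finset.univ := by
    rcases hcard m with h1 | h1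
    · exact (Finset.card_eq_iff_eq_univ _).1
        (le_antisymm (Finset.card_le_univ _) (by simpa using h1))
    · exact h1
  have hup : ∀ i, z i < z i₀ + m * η := fun i => by
    have hi := huniv ▸ Finset.mem_univ i
    simpa [S] using hi
  rw [abs_le]
  constructor <;> linarith [hup a, hup b, hi₀ a, hi₀ b]

/-- Along a sequence of gossip steps the differences of the chosen pairs tend to zero. -/
theorem eventually_abs_sub_lt_of_gossip {m : ℕ} {G : ℕ → Matrix (Fin m) (Fin m) ℝ}
    (hG : ∀ k, ∃ i j, i ≠ j ∧ G k = gossipMatrix i j) {z : ℕ → Fin m → ℝ}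
    (hz : ∀ k, z (k + 1) = G k *ᵥ z k) {η : ℝ} (hη : 0 < η) :
    ∀ᶠ k in atTop, ∀ i j, i ≠ j → G k = gossipMatrix i j → |z k i - z k j| < η := by
  let V : ℕ → ℝ := fun k => ∑ i, z k i ^ 2
  have hstep : ∀ k i j, i ≠ j → G k = gossipMatrix i j →
      V (k + 1) = V k - (z k i - z k j) ^ 2 / 2 := by
    intro k i j hij hk
    simp only [V, hz, hk]
    exact sum_sq_gossipMatrix_mulVec hij (z k)
  have hanti : Antitone V := by
    refine antitone_nat_of_succ_le fun k => ?_
    obtain ⟨i, j, hij, hk⟩ := hG k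
    rw [hstep k i j hij hk]
    linarith [sq_nonneg (z k i - z k j)]
  have hbdd : BddBelow (Set.range V) := by
    refine ⟨0, ?_⟩
    rintro _ ⟨k, rfl⟩
    exact Finset.sum_nonneg fun i _ => sq_nonneg _
  have hlim := tendsto_atTop_ciInf hanti hbdd
  have hdiff := hlim.sub (hlim.comp (tendsto_add_atTop_nat 1))
  rw [sub_self] at hdiff
  -- `V` converges, so its decrements, half the squared differences, fall below `η ^ 2 / 2`.
  filter_upwards [hdiff.eventually (gt_mem_nhds (show (0 : ℝ) < η ^ 2 / 2 by positivity))]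
    with k hk i j hij hkij
  refine abs_lt_of_sq_lt_sq ?_ hη.le
  simp only [Function.comp_apply, hstep k i j hij hkij] at hk
  linarith

/-- Gossip steps that cross every cut infinitely often lead to a consensus. -/
theorem reachesConsensus_of_frequently_cross {m : ℕ} {G : ℕ → Matrix (Fin m) (Fin m) ℝ}
    (hG : ∀ k, ∃ i j, i ≠ j ∧ G k = gossipMatrix i j)
    (hcross : ∀ S : Finset (Fin m), S.Nonempty → S ≠ Finset.univ →
      ∃ᶠ k in atTop, ∃ i ∈ S, ∃ j ∉ S, G k = gossipMatrix i j) :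
    ReachesConsensus G := by
  intro z hz
  have hspread : ∀ η : ℝ, 0 < η → ∀ᶠ k in atTop, ∀ a b, |z k a - z k b| ≤ m * η := by
    intro η hη
    obtain ⟨K, hK⟩ := eventually_atTop.1 (eventually_abs_sub_lt_of_gossip hG hz hη)
    refine eventually_atTop.2 ⟨K, fun k hk => abs_sub_le_of_forall_not_gap hη ?_⟩
    by_contra! hgap
    obtain ⟨S, hS, hSu, hgap⟩ := hgap
    have hkeep : ∀ n ≥ k, ∀ i ∈ S, ∀ j ∉ S, z n i + η ≤ z n j := by
      intro n hn
      induction n, hn using Nat.le_induction with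
      | base => exact hgap
      | succ n hn ih =>
        obtain ⟨a, b, hab, hGn⟩ := hG n
        rw [hz, hGn]
        exact gap_gossipMatrix_mulVec ih hab (hK n (hk.trans hn) a b hab hGn)
    obtain ⟨n, hn, i, hi, j, hj, hGn⟩ := (frequently_atTop.1 (hcross S hS hSu)) k
    have h1 := hK n (hk.trans hn) i j (fun h => hj (h ▸ hi)) hGn
    linarith [hkeep n hn i hi j hj, (abs_lt.1 h1).1]
  have hsum : ∀ k, ∑ i, z k i = ∑ i, z 0 i := by
    intro k
    induction k with
    | zero => rfl
    | succ k ih =>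
      obtain ⟨a, b, -, hGk⟩ := hG k
      rw [hz, hGk, sum_gossipMatrix_mulVec, ih]
  refine ⟨(∑ i, z 0 i) / m, ?_⟩
  have hcoord : Tendsto (fun k i => z k i - (∑ i, z 0 i) / m) atTop (𝓝 (0 : Fin m → ℝ)) := by
    refine tendsto_pi_nhds.2 fun i => Metric.tendsto_nhds.2 fun ε hε => ?_
    have hm : (0 : ℝ) < m := Nat.cast_pos.2 i.pos
    -- This choice makes the spread at most `ε / 2`, which also bounds the distance to the mean.
    filter_upwards [hspread (ε / (2 * m)) (by positivity)] with k hk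
    have hmean : z k i - (∑ i, z 0 i) / m = (∑ j, (z k i - z k j)) / m := by
      rw [Finset.sum_sub_distrib, hsum k, Finset.sum_const, Finset.card_univ, Fintype.card_fin,
        nsmul_eq_mul, sub_div, mul_div_cancel_left₀ _ hm.ne']
    have hbound : |∑ j, (z k i - z k j)| ≤ m * (ε / 2) := by
      refine (Finset.abs_sum_le_sum_abs _ _).trans
        ((Finset.sum_le_sum fun j _ => hk i j).trans_eq ?_)
      rw [Finset.sum_const, Finset.card_univ, Fintype.card_fin, nsmul_eq_mul]
      field_simp
    rw [hmean, Pi.zero_apply, dist_zero_right, Real.norm_eq_abs, abs_div, abs_of_pos hm,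
      div_lt_iff₀ hm]
    nlinarith
  have h := ((PiLp.continuous_toLp 2 fun _ : Fin m => ℝ).tendsto 0).comp hcoord
  simpa using h.norm

/-! ### Almost sure crossing of cuts. -/

instance gossipMatrixMeasurableSingletonClass {m : ℕ} :
    MeasurableSingletonClass (Matrix (Fin m) (Fin m) ℝ) :=
  inferInstanceAs (MeasurableSingletonClass (Fin m → Fin m → ℝ))

theorem measurableSet_exists_eq_gossipMatrix {m : ℕ} (T : Finset (Fin m × Fin m)) :
    MeasurableSet {A | ∃ p ∈ T, A = gossipMatrix p.1 p.2} := by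
  have h : {A | ∃ p ∈ T, A = gossipMatrix p.1 p.2} = ⋃ p ∈ T, {gossipMatrix p.1 p.2} := by
    ext A
    simp
  rw [h]
  exact Finset.measurableSet_biUnion _ fun p _ => measurableSet_singleton _

/-- The probability that the chosen pair lies in a set of pairs that contains at most one
orientation of each. -/
theorem measureReal_exists_eq_gossipMatrix {m : ℕ} {Ω : Type*} [MeasurableSpace Ω]
    {μ : Measure Ω} [IsProbabilityMeasure μ] {P : ℕ → Fin m → Fin m → ℝ}
    {W : ℕ → Ω → Matrix (Fin m) (Fin m) ℝ} (hW : IsExtendedGossip μ P W) (k : ℕ)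
    (T : Finset (Fin m × Fin m)) (hne : ∀ p ∈ T, p.1 ≠ p.2) (hT : ∀ p ∈ T, p.swap ∉ T) :
    μ.real {ω | ∃ p ∈ T, W k ω = gossipMatrix p.1 p.2} = ∑ p ∈ T, P k p.1 p.2 := by
  have hset : {ω | ∃ p ∈ T, W k ω = gossipMatrix p.1 p.2} =
      ⋃ p ∈ T, {ω | W k ω = gossipMatrix p.1 p.2} := by
    ext ω
    simp
  rw [hset, measureReal_biUnion_finset]
  · exact Finset.sum_congr rfl fun p hp => hW.prob_eq k _ _ (hne p hp)
  · intro p hp q hq hpq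
    refine Set.disjoint_left.2 fun ω h1 h2 => ?_
    rcases eq_or_eq_of_gossipMatrix_eq (hne p hp) (h1.symm.trans h2) with h | h
    · exact hpq (Prod.ext h.1 h.2)
    · exact hT p hp (by rwa [show p.swap = q from Prod.ext h.2 h.1])
  · exact fun p _ => hW.measurable k (measurableSet_singleton _)

theorem ae_exists_eq_gossipMatrix {m : ℕ} {Ω : Type*} [MeasurableSpace Ω] {μ : Measure Ω}
    [IsProbabilityMeasure μ] {P : ℕ → Fin m → Fin m → ℝ} (hP : IsPairProbability P)
    {W : ℕ → Ω → Matrix (Fin m) (Fin m) ℝ} (hW : IsExtendedGossip μ P W) (k : ℕ) :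
    ∀ᵐ ω ∂μ, ∃ i j, i ≠ j ∧ W k ω = gossipMatrix i j := by
  -- Requiring `p.1 < p.2` counts each unordered pair once, so the total mass is one.
  have h := measureReal_exists_eq_gossipMatrix hW k
    (Finset.univ.filter fun p : Fin m × Fin m => p.1 < p.2)
    (fun p hp => (Finset.mem_filter.1 hp).2.ne)
    (fun p hp hq => lt_asymm (Finset.mem_filter.1 hp).2 (Finset.mem_filter.1 hq).2)
  have hone : ∑ p : Fin m × Fin m with p.1 < p.2, P k p.1 p.2 = 1 := by
    rw [← hP.sum_eq_one k, Finset.sum_filter, Fintype.sum_prod_type]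
    simp only [Finset.sum_filter]
  have hmeas : MeasurableSet {ω | ∃ p ∈ Finset.univ.filter fun p : Fin m × Fin m => p.1 < p.2,
      W k ω = gossipMatrix p.1 p.2} :=
    hW.measurable k (measurableSet_exists_eq_gossipMatrix _)
  rw [hone, measureReal_def, ENNReal.toReal_eq_one_iff, ← mem_ae_iff_prob_eq_one hmeas] at h
  filter_upwards [h] with ω hω
  obtain ⟨p, hp, hp'⟩ := hω
  exact ⟨p.1, p.2, (Finset.mem_filter.1 hp).2.ne, hp'⟩

/-- A cut whose probabilities have a divergent sum is almost surely crossed infinitely often. -/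
theorem ae_frequently_cross {m : ℕ} {Ω : Type*} [MeasurableSpace Ω] {μ : Measure Ω}
    [IsProbabilityMeasure μ] {P : ℕ → Fin m → Fin m → ℝ}
    {W : ℕ → Ω → Matrix (Fin m) (Fin m) ℝ} (hW : IsExtendedGossip μ P W) (S : Finset (Fin m))
    (hS : Tendsto (fun n => ∑ k ∈ Finset.range n, cutProbability (P k) S) atTop atTop) :
    ∀ᵐ ω ∂μ, ∃ᶠ k in atTop, ∃ i ∈ S, ∃ j ∉ S, W k ω = gossipMatrix i j := by
  let B : Set (Matrix (Fin m) (Fin m) ℝ) := {A | ∃ p ∈ S ×ˢ Sᶜ, A = gossipMatrix p.1 p.2}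
  have hB : MeasurableSet B := measurableSet_exists_eq_gossipMatrix _
  have hmeas : ∀ k, MeasurableSet (W k ⁻¹' B) := fun k => hW.measurable k hB
  have hprob : ∀ k, μ.real (W k ⁻¹' B) = cutProbability (P k) S := by
    intro k
    rw [cutProbability, ← Finset.sum_product' S Sᶜ fun i j => P k i j]
    refine measureReal_exists_eq_gossipMatrix hW k (S ×ˢ Sᶜ) ?_ ?_
    · intro p hp h
      rw [Finset.mem_product, Finset.mem_compl] at hp
      exact hp.2 (h ▸ hp.1)
    · intro p hp hq
      rw [Finset.mem_product, Finset.mem_compl] at hp hq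
      exact hp.2 hq.1
  have hindep : iIndepSet (fun k => W k ⁻¹' B) μ := by
    rw [iIndepSet_iff_meas_biInter hmeas]
    intro s
    exact hW.indep.measure_inter_preimage_eq_mul s fun _ _ => hB
  have htsum : ∑' k, μ (W k ⁻¹' B) = ⊤ := by
    by_contra hne
    have hsum := ENNReal.summable_toReal hne
    have hsum' : Summable fun k => cutProbability (P k) S := by
      simpa only [← hprob, measureReal_def] using hsum
    exact not_tendsto_nhds_of_tendsto_atTop hS _ hsum'.hasSum.tendsto_sum_nat
  have hlim := measure_limsup_eq_one hmeas hindep htsum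
  rw [← mem_ae_iff_prob_eq_one (.measurableSet_limsup hmeas)] at hlim
  filter_upwards [hlim] with ω hω
  rw [mem_limsup_iff_frequently_mem] at hω
  refine hω.mono fun k hk => ?_
  obtain ⟨p, hp, hp'⟩ := hk
  rw [Finset.mem_product, Finset.mem_compl] at hp
  exact ⟨p.1, hp.1, p.2, hp.2, hp'⟩

theorem mainTheorem9 {m : ℕ} {Ω : Type*} [MeasurableSpace Ω] (μ : Measure Ω)
    [IsProbabilityMeasure μ] (P : ℕ → Fin m → Fin m → ℝ) (hP : IsPairProbability P)
    (W : ℕ → Ω → Matrix (Fin m) (Fin m) ℝ) (hW : IsExtendedGossip μ P W)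
    (hflow : ∀ S : Finset (Fin m), S.Nonempty → S ≠ Finset.univ →
      Tendsto (fun n => ∑ k ∈ Finset.range n, cutProbability (P k) S) atTop atTop) :
    ∀ᵐ ω ∂μ, ReachesConsensus (fun k => W k ω) := by
  have hcross : ∀ᵐ ω ∂μ, ∀ S : Finset (Fin m), S.Nonempty → S ≠ Finset.univ →
      ∃ᶠ k in atTop, ∃ i ∈ S, ∃ j ∉ S, W k ω = gossipMatrix i j := by
    refine ae_all_iff.2 fun S => ?_
    by_cases h : S.Nonempty ∧ S ≠ Finset.univ
    · filter_upwards [ae_frequently_cross hW S (hflow S h.1 h.2)] with ω hω _ _ using hω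
    · exact ae_of_all _ fun ω h1 h2 => absurd ⟨h1, h2⟩ h
  filter_upwards [ae_all_iff.2 (ae_exists_eq_gossipMatrix hP hW), hcross] with ω h1 h2
  exact reachesConsensus_of_frequently_cross h1 h2
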